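/- Let $\mathbb{T}$ be a time scale (a nonempty closed subset of $\mathbb{R}$), let $a,b\in\mathbb{T}$ with $a<b$, and let $I_{\mathbb{T}}=[a,\infty)\cap\mathbb{T}$. All integrals are delta integrals on the time scale $I_{\mathbb{T}}$: $\int_r^s p(t)\,\Delta t=F(s)-F(r)$, where $F$ is a delta antiderivative of $p$. Write $\sigma(t)=\inf\{s\in I_{\mathbb{T}}: s>t\}$ (and $\sigma(t)=t$ if $t=\max I_{\mathbb{T}}$), $\mu(t)=\sigma(t)-t$, and, for rd-continuous $p:I_{\mathbb{T}}\to[0,\infty)$, $$e_p(t,s)=\exp\Big(\int_s^t\xi_{\mu(\tau)}(p(\tau))\,\Delta\tau\Big),\qquad \xi_0(z)=z,\quad \xi_h(z)=\frac{\log(1+hz)}{h}\ \ (h\neq0).$$ Let $u,f,g,h:I_{\mathbb{T}}\to[0,\infty)$ be rd-continuous (continuous at right-dense points, with finite left-sided limits at left-dense points), let $k\ge 0$ be a real constant, and assume that $$u(t)\le k+\int_a^t f(s)\Big[u(s)+\int_a^s g(\tau)u(\tau)\,\Delta\tau+\int_a^b h(\tau)u(\tau)\,\Delta\tau\Big]\Delta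 s\qquad\text{for all } t\in I_{\mathbb{T}}.$$ If $$r=\int_a^b h(\tau)\,e_{f+g}(\tau,a)\,\Delta\tau<1,$$ then $$u(t)\le\frac{k}{1-r}\,e_{f+g}(t,a)\qquad\text{for all } t\in I_{\mathbb{T}}.$$ -/

import Mathlib

open Filter Topology Set

noncomputable section

namespace TimeScale

/-- A time scale is a nonempty closed subset of the real line. Throughout, a function on a time
scale `S` is represented by a function `ℝ → ℝ` of which only the values on `S` matter. -/
def IsTimeScale (S : Set ℝ) : Prop :=
  S.Nonempty ∧ IsClosed S

/-- The interval `[a, ∞) ∩ 𝕋` of a time scale `𝕋`; it is again a time scale if `a ∈ 𝕋`. -/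
def halfLine (T : Set ℝ) (a : ℝ) : Set ℝ :=
  T ∩ Ici a

open Classical in
/-- Forward jump operator `σ(t) = inf {s ∈ S : s > t}`, with `σ(t) = t` if `t` is the maximum
of `S` (the convention `inf ∅ = sup S`). -/
def sigma (S : Set ℝ) (t : ℝ) : ℝ :=
  if (S ∩ Ioi t).Nonempty then sInf (S ∩ Ioi t) else t

open Classical in
/-- Backward jump operator `ρ(t) = sup {s ∈ S : s < t}`, with `ρ(t) = t` if `t` is the minimum
of `S` (the convention `sup ∅ = inf S`). -/
def rho (S : Set ℝ) (t : ℝ) : ℝ :=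
  if (S ∩ Iio t).Nonempty then sSup (S ∩ Iio t) else t

/-- Graininess `μ(t) = σ(t) - t`. -/
def graininess (S : Set ℝ) (t : ℝ) : ℝ :=
  sigma S t - t

/-- `t` is right-dense: `t < sup S` and `σ(t) = t`. -/
def IsRightDense (S : Set ℝ) (t : ℝ) : Prop :=
  t ∈ S ∧ (S ∩ Ioi t).Nonempty ∧ sigma S t = t

/-- `t` is left-dense: `t > inf S` and `ρ(t) = t`. -/
def IsLeftDense (S : Set ℝ) (t : ℝ) : Prop :=
  t ∈ S ∧ (S ∩ Iio t).Nonempty ∧ rho S t = t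

/-- rd-continuity on `S`: continuity at the right-dense points and finite left-sided limits at the
left-dense points. -/
def RdContinuous (S : Set ℝ) (f : ℝ → ℝ) : Prop :=
  (∀ t, IsRightDense S t → ContinuousWithinAt f S t) ∧
  (∀ t, IsLeftDense S t → ∃ L : ℝ, Tendsto f (𝓝[S ∩ Iio t] t) (𝓝 L))

/-- `f` has the delta derivative `d` at the point `t` of the time scale `S`. -/
def HasDeltaDerivAt (S : Set ℝ) (f : ℝ → ℝ) (d t : ℝ) : Prop :=
  ∀ ε > 0, ∃ U ∈ 𝓝 t, ∀ s ∈ U ∩ S,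
    |(f (sigma S t) - f s) - d * (sigma S t - s)| ≤ ε * |sigma S t - s|

/-- `F` is an antiderivative of `f` on `S`: `F` is continuous and `F^Δ = f` at every point of `S`
other than its maximum (if there is one).

At a left-scattered maximum `F^Δ = f` is no condition (that point is not in `S^κ`). At a
left-dense maximum `m` only the continuity of `F` is asked for: an rd-continuous `f` may be
discontinuous at `m`, and then no `F` has `F^Δ = f` on all of `S`. A function `F` with
`F^Δ = f` on all of `S^κ` is always an antiderivative in this sense, and antiderivatives in this
sense are unique up to constants, so the integral below is the usual one. -/
def IsAntiderivative (S : Set ℝ) (F f : ℝ → ℝ) : Prop :=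
  ContinuousOn F S ∧ ∀ t ∈ S, (S ∩ Ioi t).Nonempty → HasDeltaDerivAt S F (f t) t

open Classical in
/-- The delta integral `∫_r^s f(t) Δt = F(s) - F(r)`, where `F` is an antiderivative of `f` on `S`
(and the value `0` if there is none, which does not happen for rd-continuous `f`). -/
def deltaIntegral (S : Set ℝ) (r s : ℝ) (f : ℝ → ℝ) : ℝ :=
  if hf : ∃ F, IsAntiderivative S F f then hf.choose s - hf.choose r else 0

/-- The cylinder transformation `ξ_h(z)`, for real `z` with `1 + h z > 0`. -/
def cylinder (h z : ℝ) : ℝ :=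
  if h = 0 then z else Real.log (1 + h * z) / h

/-- The generalized exponential function `e_p(t, s)` of the time scale `S`, for positively
regressive `p` (that is, `1 + μ p > 0`; in particular for `p ≥ 0`). -/
def expTS (S : Set ℝ) (p : ℝ → ℝ) (t s : ℝ) : ℝ :=
  Real.exp (deltaIntegral S s t fun τ => cylinder (graininess S τ) (p τ))

end TimeScale

end

/-! Write `c` for the constant `∫_a^b h u`, `G(t) = ∫_a^t g u` and `W(t) = ∫_a^t f (u + G + c)`. The
hypothesis says `u ≤ k + W`. The function `V = k + c + W + G` dominates both `u` and `u + G + c`,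
because `G` and `c` are nonnegative, so `V^Δ = f (u + G + c) + g u ≤ (f + g) V` with `V(a) = k + c`.
The comparison lemma `le_mul_expTS` gives `u ≤ V ≤ (k + c) e_{f+g}(·, a)`. Multiplying by `h` and
integrating over `[a, b]` bounds `c` by itself: `c ≤ (k + c) r`. Since `r < 1`, this rearranges to
`k + c ≤ k / (1 - r)`.

The comparison rests on `antitoneOn_of_jump_of_deriv`, applied to `V / e_{f+g}`. The delta integral
has a default value when no antiderivative exists, so existence is proved for rd-continuous
functions (`RdContinuous.exists_isAntiderivative`), by Lebesgue integration of the extension that is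
constant across gaps. -/

namespace TimeScale

/-! ### Jump operators, gaps and graininess -/

section Jump

variable {S : Set ℝ} {t : ℝ}

theorem sigma_eq_sInf (hne : (S ∩ Ioi t).Nonempty) : sigma S t = sInf (S ∩ Ioi t) := if_pos hne

theorem le_sigma (S : Set ℝ) (t : ℝ) : t ≤ sigma S t := by
  unfold sigma
  split_ifs with hne
  · exact le_csInf hne fun x hx => hx.2.le
  · exact le_rfl

theorem sigma_le {y : ℝ} (hy : y ∈ S) (hty : t < y) : sigma S t ≤ y := by
  rw [sigma_eq_sInf ⟨y, hy, hty⟩]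
  exact csInf_le ⟨t, fun x hx => hx.2.le⟩ ⟨hy, hty⟩

theorem sigma_mem (hS : IsClosed S) (ht : t ∈ S) : sigma S t ∈ S := by
  unfold sigma
  split_ifs with hne
  · exact closure_minimal inter_subset_left hS
      (csInf_mem_closure hne ⟨t, fun x hx => hx.2.le⟩)
  · exact ht

theorem graininess_nonneg (S : Set ℝ) (t : ℝ) : 0 ≤ graininess S t :=
  sub_nonneg.2 (le_sigma S t)

/-- To the right of a point which is not right-dense there is a gap. -/
theorem exists_gap_right (ht : t ∈ S) (h : ¬ IsRightDense S t) :
    ∃ d > t, ∀ s ∈ S, t < s → d ≤ s := by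
  by_cases hne : (S ∩ Ioi t).Nonempty
  · refine ⟨sigma S t, (le_sigma S t).lt_of_ne fun h' => h ⟨ht, hne, h'.symm⟩,
      fun s hs hts => sigma_le hs hts⟩
  · exact ⟨t + 1, by linarith, fun s hs hts => (hne ⟨s, hs, hts⟩).elim⟩

/-- To the left of a point which is not left-dense there is a gap. -/
theorem exists_gap_left (ht : t ∈ S) (h : ¬ IsLeftDense S t) :
    ∃ d < t, ∀ s ∈ S, s < t → s ≤ d := by
  by_cases hne : (S ∩ Iio t).Nonempty
  · have hrho : rho S t = sSup (S ∩ Iio t) := if_pos hne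
    have hle : rho S t ≤ t := hrho ▸ csSup_le hne fun x hx => hx.2.le
    refine ⟨rho S t, hle.lt_of_ne fun h' => h ⟨ht, hne, h'⟩, fun s hs hst => ?_⟩
    rw [hrho]
    exact le_csSup ⟨t, fun x hx => hx.2.le⟩ ⟨hs, hst⟩
  · exact ⟨t - 1, by linarith, fun s hs hst => (hne ⟨s, hs, hst⟩).elim⟩

theorem IsRightDense.exists_mem_Ioo (h : IsRightDense S t) {c : ℝ} (hc : t < c) :
    ∃ y ∈ S, t < y ∧ y < c := by
  obtain ⟨-, hne, hs⟩ := h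
  rw [sigma_eq_sInf hne] at hs
  obtain ⟨y, hy, hyc⟩ := exists_lt_of_csInf_lt hne (hs.trans_lt hc)
  exact ⟨y, hy.1, hy.2, hyc⟩

theorem nhdsWithin_Iio_eq_bot (ht : t ∈ S) (h : ¬ IsLeftDense S t) : 𝓝[S ∩ Iio t] t = ⊥ := by
  obtain ⟨d, hd, hgap⟩ := exists_gap_left ht h
  rw [← empty_mem_iff_bot, mem_nhdsWithin]
  exact ⟨Ioi d, isOpen_Ioi, hd, fun s hs => (hgap s hs.2.1 hs.2.2).not_gt hs.1⟩

theorem nhdsWithin_Ioi_eq_bot (ht : t ∈ S) (h : ¬ IsRightDense S t) : 𝓝[S ∩ Ioi t] t = ⊥ := by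
  obtain ⟨d, hd, hgap⟩ := exists_gap_right ht h
  rw [← empty_mem_iff_bot, mem_nhdsWithin]
  exact ⟨Iio d, isOpen_Iio, hd, fun s hs => (hgap s hs.2.1 hs.2.2).not_gt hs.1⟩

/-- Lets local statements be checked separately on the left, at the point and on the right, as the
one-sided form of rd-continuity requires. -/
theorem nhdsWithin_eq_sup (ht : t ∈ S) :
    𝓝[S] t = 𝓝[S ∩ Iio t] t ⊔ pure t ⊔ 𝓝[S ∩ Ioi t] t := by
  rw [← nhdsWithin_singleton, ← nhdsWithin_union, ← nhdsWithin_union]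
  congr 1
  ext s
  simp only [mem_union, mem_inter_iff, mem_Iio, mem_singleton_iff, mem_Ioi]
  constructor
  · intro hs
    rcases lt_trichotomy s t with h | h | h <;> tauto
  · rintro ((h | h) | h)
    exacts [h.1, h ▸ ht, h.1]

/-- The graininess tends to `0` at right-dense points. -/
theorem IsRightDense.tendsto_graininess (h : IsRightDense S t) :
    Tendsto (graininess S) (𝓝[S] t) (𝓝 0) := by
  rw [Metric.tendsto_nhds]
  intro ε hε
  obtain ⟨y, hy, hty, hyε⟩ := h.exists_mem_Ioo (show t < t + ε / 2 by linarith)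
  filter_upwards [mem_nhdsWithin_of_mem_nhds (Ioo_mem_nhds (show t - ε / 2 < t by linarith) hty)]
    with s hs
  rw [Real.dist_eq, sub_zero, abs_of_nonneg (graininess_nonneg S s)]
  have := sigma_le hy hs.2
  unfold graininess
  linarith [hs.1]

/-- The graininess tends to `0` from the left at every point. -/
theorem tendsto_graininess_left (ht : t ∈ S) :
    Tendsto (graininess S) (𝓝[S ∩ Iio t] t) (𝓝 0) := by
  rw [Metric.tendsto_nhds]
  intro ε hε
  filter_upwards [mem_nhdsWithin_of_mem_nhds (Ioi_mem_nhds (show t - ε < t by linarith)),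
    self_mem_nhdsWithin] with s hs hs'
  rw [Real.dist_eq, sub_zero, abs_of_nonneg (graininess_nonneg S s)]
  have := sigma_le ht hs'.2
  have := mem_Ioi.1 hs
  unfold graininess
  linarith

end Jump

/-! ### Delta derivatives and monotonicity -/

section Derivative

variable {S : Set ℝ} {t d : ℝ} {F : ℝ → ℝ}

theorem HasDeltaDerivAt.hasDerivWithinAt (h : HasDeltaDerivAt S F d t) (hs : sigma S t = t) :
    HasDerivWithinAt F d S t := by
  rw [hasDerivWithinAt_iff_isLittleO, Asymptotics.isLittleO_iff]
  intro ε hε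
  obtain ⟨U, hU, hUS⟩ := h ε hε
  filter_upwards [mem_nhdsWithin_of_mem_nhds hU, self_mem_nhdsWithin] with s hsU hsS
  have := hUS s ⟨hsU, hsS⟩
  rw [hs] at this
  rw [Real.norm_eq_abs, Real.norm_eq_abs, abs_sub_comm s t, smul_eq_mul]
  convert this using 1
  rw [← abs_neg]
  congr 1
  ring

/-- The value of a delta differentiable function after a jump. -/
theorem HasDeltaDerivAt.apply_sigma (h : HasDeltaDerivAt S F d t) (ht : t ∈ S) :
    F (sigma S t) = F t + d * graininess S t := by
  have key : ∀ ε > 0, |F (sigma S t) - F t - d * graininess S t| ≤ ε * graininess S t := by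
    intro ε hε
    obtain ⟨U, hU, hUS⟩ := h ε hε
    have := hUS t ⟨mem_of_mem_nhds hU, ht⟩
    rwa [abs_of_nonneg (sub_nonneg.2 (le_sigma S t))] at this
  have h0 : |F (sigma S t) - F t - d * graininess S t| ≤ 0 := by
    refine le_of_forall_pos_le_add fun ε hε => ?_
    have hμ := graininess_nonneg S t
    have hpos : 0 < graininess S t + 1 := by linarith
    refine (key (ε / (graininess S t + 1)) (by positivity)).trans ?_
    rw [zero_add, div_mul_eq_mul_div, div_le_iff₀ hpos]
    nlinarith
  have := abs_nonpos_iff.1 h0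
  linarith

/-- A continuous function which decreases across jumps and has nonpositive derivative at the
right-dense points is antitone. -/
theorem antitoneOn_of_jump_of_deriv (hS : IsClosed S) (hc : ContinuousOn F S)
    (hjump : ∀ t ∈ S, (S ∩ Ioi t).Nonempty → F (sigma S t) ≤ F t)
    (hderiv : ∀ t, IsRightDense S t → ∃ d ≤ 0, HasDerivWithinAt F d S t) :
    AntitoneOn F S := by
  intro x hx y hy hxy
  refine le_of_forall_pos_le_add fun η hη => ?_
  obtain ⟨ε, hε, hεη⟩ : ∃ ε > 0, ε * (y - x) ≤ η := by
    have : 0 < y - x + 1 := by linarith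
    refine ⟨η / (y - x + 1), by positivity, ?_⟩
    rw [div_mul_eq_mul_div, div_le_iff₀ this]
    nlinarith
  -- Continuous induction: were the last point `c` of the compact set `A` below `y`, a jump or a
  -- nonpositive derivative at `c` would give a later point of `A`. The slope `ε` absorbs the
  -- little-o error in the right-dense case.
  set A : Set ℝ := {s ∈ S ∩ Icc x y | F s ≤ F x + ε * (s - x)} with hA
  have hcpt : IsCompact (S ∩ Icc x y) := isCompact_Icc.inter_left hS
  have hAcl : IsCompact A := by
    refine hcpt.of_isClosed_subset ?_ (sep_subset _ _)
    exact hcpt.isClosed.isClosed_le (hc.mono inter_subset_left) (by fun_prop)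
  have hAne : A.Nonempty := ⟨x, ⟨hx, le_rfl, hxy⟩, by simp⟩
  obtain ⟨c, ⟨⟨hcS, hxc, hcy⟩, hcF⟩, hcmax⟩ := hAcl.exists_isGreatest hAne
  rcases hcy.eq_or_lt with rfl | hlt
  · linarith
  exfalso
  have hne : (S ∩ Ioi c).Nonempty := ⟨y, hy, hlt⟩
  suffices ∃ z ∈ A, c < z by
    obtain ⟨z, hz, hcz⟩ := this
    exact (hcmax hz).not_gt hcz
  rcases (le_sigma S c).eq_or_lt with heq | hσ
  · have hrd : IsRightDense S c := ⟨hcS, hne, heq.symm⟩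
    obtain ⟨d, hd, hder⟩ := hderiv c hrd
    rw [hasDerivWithinAt_iff_isLittleO, Asymptotics.isLittleO_iff] at hder
    have hev := hder hε
    rw [eventually_nhdsWithin_iff] at hev
    obtain ⟨r, hr, hball⟩ := Metric.eventually_nhds_iff.1 hev
    obtain ⟨z, hzS, hcz, hzr⟩ := hrd.exists_mem_Ioo (show c < min (c + r) y from
      lt_min (by linarith) hlt)
    have hz := hball (y := z) (by
      rw [Real.dist_eq, abs_of_pos (by linarith)]
      linarith [hzr.trans_le (min_le_left _ _)]) hzS
    refine ⟨z, ⟨⟨hzS, by linarith, (hzr.trans_le (min_le_right _ _)).le⟩, ?_⟩, hcz⟩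
    rw [Real.norm_eq_abs, Real.norm_eq_abs, abs_of_pos (show 0 < z - c by linarith),
      smul_eq_mul] at hz
    have := (abs_le.1 hz).2
    nlinarith
  · refine ⟨sigma S c, ⟨⟨sigma_mem hS hcS, by linarith, sigma_le hy hlt⟩, ?_⟩, hσ⟩
    have := hjump c hcS hne
    nlinarith

/-- A continuous function with nonnegative delta derivative is monotone. -/
theorem IsAntiderivative.monotoneOn {f : ℝ → ℝ} (hS : IsClosed S) (hF : IsAntiderivative S F f)
    (hf : ∀ t ∈ S, 0 ≤ f t) : MonotoneOn F S := by
  have : AntitoneOn (fun x => -F x) S := by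
    refine antitoneOn_of_jump_of_deriv hS hF.1.neg (fun t ht hne => ?_) fun t ht => ?_
    · have := (hF.2 t ht hne).apply_sigma ht
      have := mul_nonneg (hf t ht) (graininess_nonneg S t)
      linarith
    · exact ⟨-f t, by linarith [hf t ht.1], ((hF.2 t ht.1 ht.2.1).hasDerivWithinAt ht.2.2).neg⟩
  intro x hx y hy hxy
  have := this hx hy hxy
  simpa using this

theorem HasDeltaDerivAt.add {F₁ F₂ : ℝ → ℝ} {d₁ d₂ : ℝ} (h₁ : HasDeltaDerivAt S F₁ d₁ t)
    (h₂ : HasDeltaDerivAt S F₂ d₂ t) :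
    HasDeltaDerivAt S (fun x => F₁ x + F₂ x) (d₁ + d₂) t := by
  intro ε hε
  obtain ⟨U, hU, hUS⟩ := h₁ (ε / 2) (half_pos hε)
  obtain ⟨V, hV, hVS⟩ := h₂ (ε / 2) (half_pos hε)
  refine ⟨U ∩ V, inter_mem hU hV, fun s hs => ?_⟩
  have h1 := hUS s ⟨hs.1.1, hs.2⟩
  have h2 := hVS s ⟨hs.1.2, hs.2⟩
  calc _ = |(F₁ (sigma S t) - F₁ s - d₁ * (sigma S t - s))
          + (F₂ (sigma S t) - F₂ s - d₂ * (sigma S t - s))| := by congr 1; ring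
    _ ≤ _ := abs_add_le _ _
    _ ≤ _ := by linarith

theorem HasDeltaDerivAt.const_mul (c : ℝ) (h : HasDeltaDerivAt S F d t) :
    HasDeltaDerivAt S (fun x => c * F x) (c * d) t := by
  intro ε hε
  have hc : 0 < |c| + 1 := by positivity
  obtain ⟨U, hU, hUS⟩ := h (ε / (|c| + 1)) (by positivity)
  refine ⟨U, hU, fun s hs => ?_⟩
  calc _ = |c * (F (sigma S t) - F s - d * (sigma S t - s))| := by congr 1; ring
    _ = |c| * |F (sigma S t) - F s - d * (sigma S t - s)| := abs_mul _ _
    _ ≤ (|c| + 1) * (ε / (|c| + 1) * |sigma S t - s|) := by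
        gcongr
        · linarith
        · exact hUS s hs
    _ = _ := by field_simp

theorem IsAntiderivative.add {F₁ F₂ f₁ f₂ : ℝ → ℝ} (h₁ : IsAntiderivative S F₁ f₁)
    (h₂ : IsAntiderivative S F₂ f₂) :
    IsAntiderivative S (fun x => F₁ x + F₂ x) (fun x => f₁ x + f₂ x) :=
  ⟨h₁.1.add h₂.1, fun t ht hne => (h₁.2 t ht hne).add (h₂.2 t ht hne)⟩

theorem IsAntiderivative.const_mul {f : ℝ → ℝ} (c : ℝ) (h : IsAntiderivative S F f) :
    IsAntiderivative S (fun x => c * F x) (fun x => c * f x) :=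
  ⟨continuousOn_const.mul h.1, fun t ht hne => (h.2 t ht hne).const_mul c⟩

theorem IsAntiderivative.add_const {f : ℝ → ℝ} (c : ℝ) (h : IsAntiderivative S F f) :
    IsAntiderivative S (fun x => F x + c) f := by
  refine ⟨h.1.add continuousOn_const, fun t ht hne ε hε => ?_⟩
  simpa only [add_sub_add_right_eq_sub] using h.2 t ht hne ε hε

end Derivative

/-! ### Rd-continuous functions and the cylinder transformation -/

section RdContinuous

variable {S : Set ℝ} {f g : ℝ → ℝ}

theorem RdContinuous.add (hf : RdContinuous S f) (hg : RdContinuous S g) :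
    RdContinuous S (fun x => f x + g x) :=
  ⟨fun t ht => (hf.1 t ht).add (hg.1 t ht), fun t ht => by
    obtain ⟨L, hL⟩ := hf.2 t ht
    obtain ⟨M, hM⟩ := hg.2 t ht
    exact ⟨L + M, hL.add hM⟩⟩

theorem RdContinuous.mul (hf : RdContinuous S f) (hg : RdContinuous S g) :
    RdContinuous S (fun x => f x * g x) :=
  ⟨fun t ht => (hf.1 t ht).mul (hg.1 t ht), fun t ht => by
    obtain ⟨L, hL⟩ := hf.2 t ht
    obtain ⟨M, hM⟩ := hg.2 t ht
    exact ⟨L * M, hL.mul hM⟩⟩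

theorem RdContinuous.of_continuousOn (hf : ContinuousOn f S) : RdContinuous S f :=
  ⟨fun t ht => hf t ht.1, fun t ht => ⟨f t, (hf t ht.1).mono inter_subset_left⟩⟩

/-- An rd-continuous function is locally bounded. -/
theorem RdContinuous.eventually_bounded (hf : RdContinuous S f) {t : ℝ} (ht : t ∈ S) :
    ∃ C, ∀ᶠ s in 𝓝[S] t, |f s| ≤ C := by
  have hl : ∃ C, ∀ᶠ s in 𝓝[S ∩ Iio t] t, |f s| ≤ C := by
    by_cases h : IsLeftDense S t
    · obtain ⟨L, hL⟩ := hf.2 t h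
      exact ⟨|L| + 1, hL.abs.eventually_le_const (lt_add_one _)⟩
    · exact ⟨0, by simp [nhdsWithin_Iio_eq_bot ht h]⟩
  have hr : ∃ C, ∀ᶠ s in 𝓝[S ∩ Ioi t] t, |f s| ≤ C := by
    by_cases h : IsRightDense S t
    · exact ⟨|f t| + 1, ((hf.1 t h).mono inter_subset_left).tendsto.abs.eventually_le_const
        (lt_add_one _)⟩
    · exact ⟨0, by simp [nhdsWithin_Ioi_eq_bot ht h]⟩
  obtain ⟨C₁, h₁⟩ := hl
  obtain ⟨C₂, h₂⟩ := hr
  refine ⟨max (max C₁ |f t|) C₂, ?_⟩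
  rw [nhdsWithin_eq_sup ht, eventually_sup, eventually_sup, eventually_pure]
  refine ⟨⟨h₁.mono fun s hs => ?_, ?_⟩, h₂.mono fun s hs => ?_⟩
  · exact hs.trans ((le_max_left _ _).trans (le_max_left _ _))
  · exact (le_max_right _ _).trans (le_max_left _ _)
  · exact hs.trans (le_max_right _ _)

/-- An rd-continuous function is bounded on compact sets. -/
theorem RdContinuous.exists_bound (hf : RdContinuous S f) {K : Set ℝ} (hK : IsCompact K)
    (hKS : K ⊆ S) : ∃ C, ∀ s ∈ K, |f s| ≤ C := by
  refine hK.induction_on (p := fun A => ∃ C, ∀ s ∈ A, |f s| ≤ C) ⟨0, by simp⟩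
    (fun A B hAB ⟨C, hC⟩ => ⟨C, fun s hs => hC s (hAB hs)⟩) ?_ fun t ht => ?_
  · rintro A B ⟨C, hC⟩ ⟨D, hD⟩
    refine ⟨max C D, ?_⟩
    rintro s (hs | hs)
    exacts [(hC s hs).trans (le_max_left _ _), (hD s hs).trans (le_max_right _ _)]
  · obtain ⟨C, hC⟩ := hf.eventually_bounded (hKS ht)
    exact ⟨_, nhdsWithin_mono t hKS hC, C, fun s hs => hs⟩

/-- `ξ_h(z)` differs from `z` by at most `h z ^ 2`. -/
theorem abs_cylinder_sub_le {h z : ℝ} (hh : 0 ≤ h) (hz : 0 ≤ z) :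
    |cylinder h z - z| ≤ h * z ^ 2 := by
  unfold cylinder
  split_ifs with h0
  · simp [h0]
  have hpos : 0 < h := hh.lt_of_ne (Ne.symm h0)
  have hp : 0 < 1 + h * z := by positivity
  have h1 : Real.log (1 + h * z) / h ≤ z := by
    rw [div_le_iff₀ hpos]
    linarith [Real.log_le_sub_one_of_pos hp]
  have h2 : z - h * z ^ 2 ≤ Real.log (1 + h * z) / h := by
    rw [le_div_iff₀ hpos]
    refine le_trans ?_ (Real.one_sub_inv_le_log_of_pos hp)
    have : 1 - (1 + h * z)⁻¹ = h * z / (1 + h * z) := by field_simp; ring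
    rw [this, le_div_iff₀ hp]
    have : 0 ≤ h * z := by positivity
    -- With `x = h z`, the claim is `(x - x ^ 2) (1 + x) = x - x ^ 3 ≤ x`.
    nlinarith [pow_nonneg this 3]
  rw [abs_sub_le_iff]
  constructor <;> nlinarith [mul_nonneg hh (sq_nonneg z)]

theorem tendsto_cylinder {l : Filter ℝ} {μ p : ℝ → ℝ} {L : ℝ} (hμ : Tendsto μ l (𝓝 0))
    (hμ0 : ∀ᶠ s in l, 0 ≤ μ s) (hp : Tendsto p l (𝓝 L)) (hp0 : ∀ᶠ s in l, 0 ≤ p s) :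
    Tendsto (fun s => cylinder (μ s) (p s)) l (𝓝 L) := by
  have h0 : Tendsto (fun s => cylinder (μ s) (p s) - p s) l (𝓝 0) := by
    refine squeeze_zero_norm' (a := fun s => μ s * p s ^ 2) ?_ (by simpa using hμ.mul (hp.pow 2))
    filter_upwards [hμ0, hp0] with s h1 h2 using abs_cylinder_sub_le h1 h2
  simpa using h0.add hp

/-- In both limits that rd-continuity involves the graininess tends to `0`, so the transform has the
same limit as `p`; at a right-dense point its value is also that of `p`. -/
theorem RdContinuous.cylinder {p : ℝ → ℝ} (hp : RdContinuous S p) (hp0 : ∀ t ∈ S, 0 ≤ p t) :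
    RdContinuous S (fun τ => cylinder (graininess S τ) (p τ)) := by
  constructor
  · intro t ht
    have hval : TimeScale.cylinder (graininess S t) (p t) = p t := by
      simp [TimeScale.cylinder, graininess, ht.2.2]
    rw [ContinuousWithinAt, hval]
    exact tendsto_cylinder ht.tendsto_graininess (Eventually.of_forall fun s =>
      graininess_nonneg S s) (hp.1 t ht) (eventually_mem_nhdsWithin.mono hp0)
  · intro t ht
    obtain ⟨L, hL⟩ := hp.2 t ht
    exact ⟨L, tendsto_cylinder (tendsto_graininess_left ht.1) (Eventually.of_forall fun s =>
      graininess_nonneg S s) hL (eventually_mem_nhdsWithin.mono fun s hs => hp0 s hs.1)⟩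

end RdContinuous

/-! ### Measurability of right-continuous functions -/

section Measurability

/-- A right-continuous function on the real line is measurable. -/
theorem measurable_of_tendsto_nhdsGT {φ : ℝ → ℝ}
    (h : ∀ x, Tendsto φ (𝓝[>] x) (𝓝 (φ x))) : Measurable φ := by
  -- Sample `φ` at the first point of the grid of mesh `1 / (n + 1)` strictly to the right of `x`:
  -- each approximation depends only on an integer floor, and the sample points tend to `x` from the
  -- right.
  refine measurable_of_tendsto_metrizable
    (f := fun (n : ℕ) x => φ ((⌊((n : ℝ) + 1) * x⌋ + 1) / ((n : ℝ) + 1))) (fun n => ?_) ?_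
  · have h1 : Measurable fun m : ℤ => φ ((m + 1) / ((n : ℝ) + 1)) := measurable_from_top
    exact h1.comp (Int.measurable_floor.comp (measurable_const_mul _))
  · rw [tendsto_pi_nhds]
    intro x
    refine (h x).comp (tendsto_nhdsWithin_iff.2 ⟨?_, Eventually.of_forall fun n => ?_⟩)
    · refine tendsto_of_tendsto_of_tendsto_of_le_of_le (g := fun _ => x)
        (h := fun n : ℕ => x + 1 / ((n : ℝ) + 1)) tendsto_const_nhds ?_ (fun n => ?_) fun n => ?_
      · simpa using tendsto_const_nhds.add (tendsto_one_div_add_atTop_nhds_zero_nat (𝕜 := ℝ))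
      · have hn : (0 : ℝ) < n + 1 := by positivity
        change x ≤ _
        rw [le_div_iff₀ hn]
        linarith [Int.lt_floor_add_one (((n : ℝ) + 1) * x)]
      · have hn : (0 : ℝ) < n + 1 := by positivity
        change _ ≤ x + 1 / ((n : ℝ) + 1)
        have hmul : (x + 1 / ((n : ℝ) + 1)) * ((n : ℝ) + 1) = ((n : ℝ) + 1) * x + 1 := by
          field_simp
        rw [div_le_iff₀ hn, hmul]
        linarith [Int.floor_le (((n : ℝ) + 1) * x)]
    · have hn : (0 : ℝ) < n + 1 := by positivity
      rw [mem_Ioi, lt_div_iff₀ hn]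
      linarith [Int.lt_floor_add_one (((n : ℝ) + 1) * x)]

end Measurability

/-! ### Extension across gaps and existence of antiderivatives -/

section Floor

/-- The largest point of `S` not exceeding `x`, or the least element `a` of `S` if `x < a`. -/
noncomputable def tsFloor (S : Set ℝ) (a x : ℝ) : ℝ :=
  sSup (S ∩ Iic (max a x))

variable {S : Set ℝ} {a : ℝ}

theorem bddAbove_inter_Iic (S : Set ℝ) (c : ℝ) : BddAbove (S ∩ Iic c) :=
  ⟨c, fun _ hx => hx.2⟩

theorem tsFloor_mem (hS : IsClosed S) (ha : IsLeast S a) (x : ℝ) :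
    tsFloor S a x ∈ S ∩ Iic (max a x) :=
  (hS.inter isClosed_Iic).csSup_mem ⟨a, ha.1, mem_Iic.2 (le_max_left _ _)⟩ (bddAbove_inter_Iic S _)

theorem le_tsFloor {s x : ℝ} (hs : s ∈ S) (hsx : s ≤ x) : s ≤ tsFloor S a x :=
  le_csSup (bddAbove_inter_Iic S _) ⟨hs, hsx.trans (le_max_right _ _)⟩

theorem tsFloor_le (hS : IsClosed S) (ha : IsLeast S a) {s x : ℝ} (hs : s ∈ S) (hxs : x ≤ s) :
    tsFloor S a x ≤ s :=
  (tsFloor_mem hS ha x).2.trans (max_le (ha.2 hs) hxs)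

theorem tsFloor_eq_self (hS : IsClosed S) (ha : IsLeast S a) {s : ℝ} (hs : s ∈ S) :
    tsFloor S a s = s :=
  (tsFloor_le hS ha hs le_rfl).antisymm (le_tsFloor hs le_rfl)

theorem tsFloor_le_self (hS : IsClosed S) (ha : IsLeast S a) {x : ℝ} (hx : a ≤ x) :
    tsFloor S a x ≤ x :=
  (tsFloor_mem hS ha x).2.trans (max_le hx le_rfl)

theorem tsFloor_mono (ha : IsLeast S a) : Monotone (tsFloor S a) := fun _ _ hxy =>
  csSup_le_csSup (bddAbove_inter_Iic S _) ⟨a, ha.1, mem_Iic.2 (le_max_left _ _)⟩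
    (inter_subset_inter_right _ (Iic_subset_Iic.2 (max_le_max le_rfl hxy)))

/-- The extension `f ∘ tsFloor S a` of an rd-continuous `f` is right-continuous. -/
theorem RdContinuous.tendsto_comp_tsFloor {f : ℝ → ℝ} (hf : RdContinuous S f) (hS : IsClosed S)
    (ha : IsLeast S a) (x : ℝ) :
    Tendsto (fun y => f (tsFloor S a y)) (𝓝[>] x) (𝓝 (f (tsFloor S a x))) := by
  by_cases hrd : IsRightDense S x
  · have hfx := hf.1 x hrd
    rw [tsFloor_eq_self hS ha hrd.1]
    refine hfx.tendsto.comp (tendsto_nhdsWithin_iff.2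
      ⟨?_, Eventually.of_forall fun y => (tsFloor_mem hS ha y).1⟩)
    refine tendsto_of_tendsto_of_tendsto_of_le_of_le' (g := fun _ => x) (h := fun y => y)
      tendsto_const_nhds (tendsto_id.mono_left nhdsWithin_le_nhds) ?_ ?_
    · filter_upwards [self_mem_nhdsWithin] with y hy using le_tsFloor hrd.1 (le_of_lt hy)
    · filter_upwards [self_mem_nhdsWithin] with y hy
        using tsFloor_le_self hS ha ((ha.2 hrd.1).trans (le_of_lt hy))
  -- Here `S` has a gap just after `x`, so the floor is constant on `[x, d)`.
  · obtain ⟨d, hd, hgap⟩ : ∃ d > x, ∀ s ∈ S, x < s → d ≤ s := by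
      by_cases hx : x ∈ S
      · exact exists_gap_right hx hrd
      · obtain ⟨ε, hε, hball⟩ := Metric.isOpen_iff.1 hS.isOpen_compl x hx
        refine ⟨x + ε, by linarith, fun s hs hxs => ?_⟩
        by_contra! hlt
        refine hball ?_ hs
        rw [Metric.mem_ball, Real.dist_eq, abs_of_pos (by linarith)]
        linarith
    refine tendsto_const_nhds.congr' ?_
    filter_upwards [Ioo_mem_nhdsGT hd] with y hy
    congr 1
    refine (tsFloor_mono ha hy.1.le).antisymm ?_
    have hy' := tsFloor_mem hS ha y
    rcases le_or_gt (tsFloor S a y) x with h | h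
    · exact le_tsFloor hy'.1 h
    · have hdy := hgap _ hy'.1 h
      rcases le_max_iff.1 (mem_Iic.1 hy'.2) with h1 | h1
      · exact h1.trans (ha.2 (tsFloor_mem hS ha x).1)
      · linarith [hy.2]

theorem RdContinuous.exists_bound_comp_tsFloor {f : ℝ → ℝ} (hf : RdContinuous S f)
    (hS : IsClosed S) (ha : IsLeast S a) (c : ℝ) :
    ∃ C, ∀ x ≤ c, |f (tsFloor S a x)| ≤ C := by
  have hK : IsCompact (S ∩ Icc a (max a c)) := isCompact_Icc.inter_left hS
  obtain ⟨C, hC⟩ := hf.exists_bound hK inter_subset_left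
  refine ⟨C, fun x hx => hC _ ?_⟩
  have hm := tsFloor_mem hS ha x
  exact ⟨hm.1, ha.2 hm.1, hm.2.trans (max_le_max le_rfl hx)⟩

theorem RdContinuous.intervalIntegrable {f : ℝ → ℝ} (hf : RdContinuous S f)
    (hS : IsClosed S) (ha : IsLeast S a) (x y : ℝ) :
    IntervalIntegrable (fun z => f (tsFloor S a z)) MeasureTheory.volume x y := by
  rw [intervalIntegrable_iff]
  obtain ⟨C, hC⟩ := hf.exists_bound_comp_tsFloor hS ha (max x y)
  refine MeasureTheory.Measure.integrableOn_of_bounded (M := C) (by simp)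
    (measurable_of_tendsto_nhdsGT (hf.tendsto_comp_tsFloor hS ha)).aestronglyMeasurable ?_
  filter_upwards [MeasureTheory.ae_restrict_mem measurableSet_uIoc] with z hz
  exact hC z hz.2

/-- Every rd-continuous function on a time scale with a least element has an antiderivative. -/
theorem RdContinuous.exists_isAntiderivative {f : ℝ → ℝ} (hf : RdContinuous S f)
    (hS : IsClosed S) (ha : IsLeast S a) : ∃ F, IsAntiderivative S F f := by
  have hint := hf.intervalIntegrable hS ha
  refine ⟨fun t => ∫ x in a..t, f (tsFloor S a x),
    (intervalIntegral.continuous_primitive hint a).continuousOn, fun t ht hne ε hε => ?_⟩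
  have hsub : ∀ x y d : ℝ, (∫ z in a..y, f (tsFloor S a z)) - (∫ z in a..x, f (tsFloor S a z))
      - d * (y - x) = ∫ z in x..y, (f (tsFloor S a z) - d) := by
    intro x y d
    rw [intervalIntegral.integral_interval_sub_left (hint _ _) (hint _ _),
      intervalIntegral.integral_sub (hint _ _) intervalIntegrable_const,
      intervalIntegral.integral_const, smul_eq_mul, mul_comm]
  simp only [hsub]
  rcases (le_sigma S t).eq_or_lt with heq | hσ
  · have hrd : IsRightDense S t := ⟨ht, hne, heq.symm⟩
    rw [← heq]
    obtain ⟨δ, hδ, hball⟩ := Metric.continuousWithinAt_iff.1 (hf.1 t hrd) ε hε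
    refine ⟨Metric.ball t δ, Metric.ball_mem_nhds t hδ, fun s hs => ?_⟩
    have hsδ := abs_lt.1 (show |s - t| < δ from hs.1)
    rw [← Real.norm_eq_abs]
    refine intervalIntegral.norm_integral_le_of_norm_le_const fun z hz => ?_
    rw [Real.norm_eq_abs]
    -- For `z` between `s` and `t`, both in `S`, the floor of `z` also lies between them, so
    -- continuity at `t` along `S` suffices.
    refine (hball (tsFloor_mem hS ha z).1 ?_).le
    rw [Real.dist_eq, abs_lt]
    rcases le_total s t with hst | hst
    · rw [uIoc_of_le hst] at hz
      have h1 := le_tsFloor (a := a) hs.2 hz.1.le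
      have h2 := tsFloor_le hS ha ht hz.2
      constructor <;> linarith
    · rw [uIoc_of_ge hst] at hz
      have h1 := le_tsFloor (a := a) ht hz.1.le
      have h2 := tsFloor_le hS ha hs.2 hz.2
      constructor <;> linarith
  · obtain ⟨C, hC⟩ := hf.exists_bound_comp_tsFloor hS ha t
    have hC0 : 0 ≤ C := (abs_nonneg _).trans (hC t le_rfl)
    set m := sigma S t - t with hm
    have hmpos : 0 < m := sub_pos.2 hσ
    -- The error over `[s, t]` is at most `2 * C * (t - s)`, which must stay below `ε * m ≤ ε *
    -- (σ(t) - s)`; the `+ 1` keeps the denominator positive.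
    set δ := ε * m / (2 * C + 1) with hδdef
    have hδ : 0 < δ := by positivity
    refine ⟨Ioo (t - δ) (sigma S t), Ioo_mem_nhds (by linarith) hσ, fun s hs => ?_⟩
    have hst : s ≤ t := by
      by_contra! hlt
      exact (sigma_le hs.2 hlt).not_gt hs.1.2
    have hint' : ∀ x y, IntervalIntegrable (fun z => f (tsFloor S a z) - f t)
        MeasureTheory.volume x y := fun x y => (hint x y).sub intervalIntegrable_const
    -- The floor equals `t` throughout the open gap; its different value at the endpoint `σ(t)` is a
    -- null set.
    have hzero : ∫ z in t..sigma S t, (f (tsFloor S a z) - f t) = 0 := by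
      rw [intervalIntegral.integral_of_le hσ.le, MeasureTheory.integral_Ioc_eq_integral_Ioo]
      refine MeasureTheory.setIntegral_eq_zero_of_forall_eq_zero fun z hz => ?_
      have h1 := le_tsFloor (a := a) ht hz.1.le
      have hmem := tsFloor_mem hS ha z
      have h2 : tsFloor S a z ≤ t := by
        by_contra! hlt
        have := sigma_le hmem.1 hlt
        linarith [tsFloor_le_self hS ha ((ha.2 ht).trans hz.1.le), hz.2]
      rw [h2.antisymm h1, sub_self]
    rw [← intervalIntegral.integral_add_adjacent_intervals (hint' s t) (hint' t _), hzero, add_zero]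
    have hbd : ‖∫ z in s..t, (f (tsFloor S a z) - f t)‖ ≤ (2 * C) * |t - s| := by
      refine intervalIntegral.norm_integral_le_of_norm_le_const fun z hz => ?_
      rw [uIoc_of_le hst] at hz
      have h1 := hC z hz.2
      have h2 := hC t le_rfl
      rw [tsFloor_eq_self hS ha ht] at h2
      exact (norm_sub_le _ _).trans (by simpa [two_mul] using add_le_add h1 h2)
    refine hbd.trans ?_
    rw [abs_of_nonneg (sub_nonneg.2 hst), abs_of_nonneg (by linarith)]
    have h1 : t - s ≤ δ := by linarith [hs.1.1]
    have h2 : (2 * C + 1) * δ = ε * m := by rw [hδdef]; field_simp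
    have h3 : m ≤ sigma S t - s := by linarith
    nlinarith

end Floor

/-! ### Properties of the delta integral -/

section Integral

variable {S : Set ℝ} {a : ℝ} {f : ℝ → ℝ}

/-- The delta integral of an rd-continuous function is an antiderivative. -/
theorem RdContinuous.isAntiderivative_deltaIntegral (hf : RdContinuous S f)
    (hS : IsClosed S) (ha : IsLeast S a) (c : ℝ) :
    IsAntiderivative S (fun t => deltaIntegral S c t f) f := by
  have hex := hf.exists_isAntiderivative hS ha
  have heq : (fun t => deltaIntegral S c t f) = fun t => hex.choose t + -hex.choose c := by
    funext t
    rw [deltaIntegral, dif_pos hex, sub_eq_add_neg]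
  rw [heq]
  exact hex.choose_spec.add_const _

theorem deltaIntegral_self (S : Set ℝ) (c : ℝ) (f : ℝ → ℝ) : deltaIntegral S c c f = 0 := by
  unfold deltaIntegral
  split_ifs <;> simp

theorem RdContinuous.deltaIntegral_nonneg (hf : RdContinuous S f) (hS : IsClosed S)
    (ha : IsLeast S a) (hf0 : ∀ t ∈ S, 0 ≤ f t) {t : ℝ} (ht : t ∈ S) :
    0 ≤ deltaIntegral S a t f := by
  have := (hf.isAntiderivative_deltaIntegral hS ha a).monotoneOn hS hf0 ha.1 ht (ha.2 ht)
  simpa only [deltaIntegral_self] using this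

/-- `c G - F` is an antiderivative of `c g - f ≥ 0`, hence monotone, and it vanishes at `a`. -/
theorem RdContinuous.deltaIntegral_le_const_mul {g : ℝ → ℝ} (hf : RdContinuous S f)
    (hg : RdContinuous S g) (hS : IsClosed S) (ha : IsLeast S a) {c : ℝ}
    (hfg : ∀ t ∈ S, f t ≤ c * g t) {t : ℝ} (ht : t ∈ S) :
    deltaIntegral S a t f ≤ c * deltaIntegral S a t g := by
  have hF := hf.isAntiderivative_deltaIntegral hS ha a
  have hG := hg.isAntiderivative_deltaIntegral hS ha a
  have := ((hG.const_mul c).add (hF.const_mul (-1))).monotoneOn hS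
    (fun s hs => by linarith [hfg s hs]) ha.1 ht (ha.2 ht)
  simp only [deltaIntegral_self] at this
  linarith

end Integral

/-! ### The exponential function and comparison -/

section Exponential

variable {S : Set ℝ} {a : ℝ} {p : ℝ → ℝ}

theorem expTS_pos (S : Set ℝ) (p : ℝ → ℝ) (t s : ℝ) : 0 < expTS S p t s := Real.exp_pos _

theorem expTS_self (S : Set ℝ) (p : ℝ → ℝ) (t : ℝ) : expTS S p t t = 1 := by
  rw [expTS, deltaIntegral_self, Real.exp_zero]

theorem continuousOn_expTS (hS : IsClosed S) (ha : IsLeast S a) (hp : RdContinuous S p)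
    (hp0 : ∀ t ∈ S, 0 ≤ p t) (c : ℝ) : ContinuousOn (fun t => expTS S p t c) S :=
  ((hp.cylinder hp0).isAntiderivative_deltaIntegral hS ha c).1.rexp

/-- A jump adds `μ ξ_μ(p) = log (1 + μ p)` to the exponent; both sides of this identity are `0` when
`μ = 0`. -/
theorem expTS_sigma (hS : IsClosed S) (ha : IsLeast S a) (hp : RdContinuous S p)
    (hp0 : ∀ t ∈ S, 0 ≤ p t) (c : ℝ) {t : ℝ} (ht : t ∈ S) (hne : (S ∩ Ioi t).Nonempty) :
    expTS S p (sigma S t) c = (1 + graininess S t * p t) * expTS S p t c := by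
  have hX := (((hp.cylinder hp0).isAntiderivative_deltaIntegral hS ha c).2 t ht hne).apply_sigma ht
  have hpos : 0 < 1 + graininess S t * p t :=
    add_pos_of_pos_of_nonneg one_pos (mul_nonneg (graininess_nonneg S t) (hp0 t ht))
  have hcyl : cylinder (graininess S t) (p t) * graininess S t
      = Real.log (1 + graininess S t * p t) := by
    unfold cylinder
    split_ifs with h
    · simp [h]
    · field_simp
  simp only [expTS]
  rw [hX, hcyl, Real.exp_add, Real.exp_log hpos, mul_comm]

theorem hasDerivWithinAt_expTS (hS : IsClosed S) (ha : IsLeast S a) (hp : RdContinuous S p)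
    (hp0 : ∀ t ∈ S, 0 ≤ p t) (c : ℝ) {t : ℝ} (ht : IsRightDense S t) :
    HasDerivWithinAt (fun s => expTS S p s c) (expTS S p t c * p t) S t := by
  have hX := (((hp.cylinder hp0).isAntiderivative_deltaIntegral hS ha c).2 t ht.1
    ht.2.1).hasDerivWithinAt ht.2.2
  have hval : cylinder (graininess S t) (p t) = p t := by
    simp [cylinder, graininess, ht.2.2]
  simpa only [hval, expTS] using hX.exp

/-- Comparison with the exponential function: `v^Δ ≤ p v` implies `v(t) ≤ v(a) e_p(t, a)`. -/
theorem le_mul_expTS {v w : ℝ → ℝ} (hS : IsClosed S) (ha : IsLeast S a) (hp : RdContinuous S p)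
    (hp0 : ∀ t ∈ S, 0 ≤ p t) (hv : IsAntiderivative S v w) (hw : ∀ t ∈ S, w t ≤ p t * v t)
    {t : ℝ} (ht : t ∈ S) : v t ≤ v a * expTS S p t a := by
  -- Across a jump `v` becomes `v + μ w ≤ (1 + μ p) v`, while the exponential gains exactly the
  -- factor `1 + μ p`. At right-dense points the quotient rule gives a derivative of the sign of `w
  -- - p v`.
  have hanti : AntitoneOn (fun s => v s / expTS S p s a) S := by
    refine antitoneOn_of_jump_of_deriv hS
      (hv.1.div (continuousOn_expTS hS ha hp hp0 a) fun s _ => (expTS_pos S p s a).ne')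
      (fun s hs hne => ?_) fun s hs => ?_
    · have hE := expTS_pos S p s a
      have hμ := graininess_nonneg S s
      have hpos : 0 < 1 + graininess S s * p s :=
        add_pos_of_pos_of_nonneg one_pos (mul_nonneg hμ (hp0 s hs))
      rw [expTS_sigma hS ha hp hp0 a hs hne, (hv.2 s hs hne).apply_sigma hs,
        div_le_div_iff₀ (by positivity) hE]
      have h1 := mul_le_mul_of_nonneg_right (hw s hs) hμ
      nlinarith [mul_le_mul_of_nonneg_right h1 hE.le]
    · have hE := expTS_pos S p s a
      refine ⟨_, ?_, ((hv.2 s hs.1 hs.2.1).hasDerivWithinAt hs.2.2).div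
        (hasDerivWithinAt_expTS hS ha hp hp0 a hs) hE.ne'⟩
      refine div_nonpos_of_nonpos_of_nonneg ?_ (sq_nonneg _)
      nlinarith [mul_le_mul_of_nonneg_right (hw s hs.1) hE.le]
  have := hanti ha.1 ht (ha.2 ht)
  simp only [expTS_self, div_one] at this
  rwa [div_le_iff₀ (expTS_pos S p t a)] at this

end Exponential

end TimeScale

/-! ### The integral inequality -/

open TimeScale in
theorem theorem3p2 (T : Set ℝ) (hT : IsTimeScale T) (a b : ℝ) (ha : a ∈ T) (hb : b ∈ T)
    (hab : a < b) (u f g h : ℝ → ℝ)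
    (hu : RdContinuous (halfLine T a) u) (hu0 : ∀ t ∈ halfLine T a, 0 ≤ u t)
    (hf : RdContinuous (halfLine T a) f) (hf0 : ∀ t ∈ halfLine T a, 0 ≤ f t)
    (hg : RdContinuous (halfLine T a) g) (hg0 : ∀ t ∈ halfLine T a, 0 ≤ g t)
    (hh : RdContinuous (halfLine T a) h) (hh0 : ∀ t ∈ halfLine T a, 0 ≤ h t)
    (k : ℝ) (hk : 0 ≤ k)
    (hineq : ∀ t ∈ halfLine T a,
      u t ≤ k + deltaIntegral (halfLine T a) a t (fun s =>
        f s * (u s + deltaIntegral (halfLine T a) a s (fun τ => g τ * u τ)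
          + deltaIntegral (halfLine T a) a b (fun τ => h τ * u τ))))
    (r : ℝ)
    (hr : r = deltaIntegral (halfLine T a) a b
      (fun τ => h τ * expTS (halfLine T a) (fun x => f x + g x) τ a))
    (hr1 : r < 1) :
    ∀ t ∈ halfLine T a,
      u t ≤ k / (1 - r) * expTS (halfLine T a) (fun x => f x + g x) t a := by
  have hS : IsClosed (halfLine T a) := hT.2.inter isClosed_Ici
  have haS : IsLeast (halfLine T a) a := ⟨⟨ha, self_mem_Ici⟩, fun x hx => hx.2⟩
  have hbS : b ∈ halfLine T a := ⟨hb, hab.le⟩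
  set S := halfLine T a with hSdef
  have hgu := hg.mul hu
  have hhu := hh.mul hu
  have hG := hgu.isAntiderivative_deltaIntegral hS haS a
  have hG0 : ∀ t ∈ S, 0 ≤ deltaIntegral S a t (fun τ => g τ * u τ) := fun t ht =>
    hgu.deltaIntegral_nonneg hS haS (fun s hs => mul_nonneg (hg0 s hs) (hu0 s hs)) ht
  have hc0 : 0 ≤ deltaIntegral S a b (fun τ => h τ * u τ) :=
    hhu.deltaIntegral_nonneg hS haS (fun s hs => mul_nonneg (hh0 s hs) (hu0 s hs)) hbS
  set c := deltaIntegral S a b (fun τ => h τ * u τ) with hc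
  have hW := (hf.mul ((hu.add (RdContinuous.of_continuousOn hG.1)).add
    (RdContinuous.of_continuousOn (continuousOn_const (c := c))))).isAntiderivative_deltaIntegral
      hS haS a
  -- Adding `G` and `c` to `k + W` closes the estimate: the bracket `u + G + c` and `u` itself both
  -- lie below this one function.
  have hV := (hW.add hG).add_const (k + c)
  have hp : RdContinuous S (fun x => f x + g x) := hf.add hg
  have hp0 : ∀ t ∈ S, 0 ≤ f t + g t := fun t ht => add_nonneg (hf0 t ht) (hg0 t ht)
  have hbound : ∀ t ∈ S, u t ≤ (k + c) * expTS S (fun x => f x + g x) t a := by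
    intro t ht
    have hcomp := le_mul_expTS hS haS hp hp0 hV (fun s hs => ?_) ht
    · simp only [deltaIntegral_self, zero_add] at hcomp
      linarith [hineq t ht, hG0 t ht]
    · have h1 := hineq s hs
      have h2 := hG0 s hs
      rw [add_mul]
      refine add_le_add ?_ ?_
      · exact mul_le_mul_of_nonneg_left (by linarith) (hf0 s hs)
      · exact mul_le_mul_of_nonneg_left (by linarith) (hg0 s hs)
  -- The bound on `u` still contains the unknown `c`; integrating it against `h` yields a linear
  -- inequality for `c`.
  have hcr : c ≤ (k + c) * r := by
    rw [hr]
    refine hhu.deltaIntegral_le_const_mul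
      (hh.mul (RdContinuous.of_continuousOn (continuousOn_expTS hS haS hp hp0 a))) hS haS
      (fun t ht => ?_) hbS
    linarith [mul_le_mul_of_nonneg_left (hbound t ht) (hh0 t ht)]
  intro t ht
  refine (hbound t ht).trans (mul_le_mul_of_nonneg_right ?_ (expTS_pos S _ t a).le)
  rw [le_div_iff₀ (by linarith)]
  linarith
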